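/- **Setting.** A polynomial is $p=\sum_{I\in p(1)}y^{p[I]}$, with a set $p(1)$ of positions and a set $p[I]$ of directions at each position $I$. A map $\phi\colon p\to q$ of polynomials is a natural transformation of the associated functors on sets; equivalently, it consists of $\phi(I)\in q(1)$ for each $I\in p(1)$ and $\phi(I,j)\in p[I]$ for each $j\in q[\phi(I)]$. The category $\mathbf{Poly}$ is monoidal under the Dirichlet tensor product $p\otimes q=\sum_{(I,J)\in p(1)\times q(1)}y^{p[I]\times q[J]}$, with unit $y$. Let $[p,q]=\sum_{\phi\colon p\to q}y^{\sum_{I\in p(1)}q[\phi(I)]}$ be its internal hom. A $[p,q]$-coalgebra is a set $S$ with a function $S\to[p,q](S)$, that is, for each state $s\in S$ an action $\mathrm{act}_s\colon p\to q$ and an update $\mathrm{upd}_s\colon\sum_{I}q[\mathrm{act}_s(I)]\to S$; a coalgebra map is a function between state sets that commutes with the structure functions. For $\phi\colon p\to q$, let $\{\phi\}$ be the one-state coalgebra with action $\phi$. In the bicategory $\mathbf{Org}$ the objects are polynomials, the hom-category from $p$ to $q$ is the category of $[p,q]$-coalgebras, and the identity of $p$ is $\{\mathrm{id}_p\}$.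 The composite $\mathcal S;\mathcal S'$ of a $[p,q]$-coalgebra and a $[q,r]$-coalgebra has state set $S\times S'$, actions $\mathrm{act}_{(s,s')}=\mathrm{act}_s;\mathrm{act}_{s'}$, and updates $(I,k)\mapsto\big(\mathrm{upd}_s(I,\mathrm{act}_{s'}(\mathrm{act}_s(I),k)),\ \mathrm{upd}_{s'}(\mathrm{act}_s(I),k)\big)$. Horizontal composition of coalgebra maps is the cartesian product of functions, and the associators and unitors are the canonical bijections of products. The tensor product $\mathcal S\otimes\mathcal S'$ of a $[p,q]$-coalgebra and a $[p',q']$-coalgebra is the $[p\otimes p',q\otimes q']$-coalgebra with state set $S\times S'$, action $\mathrm{act}_s\otimes\mathrm{act}_{s'}$ and componentwise updates. **Theorem.** The bicategory $\mathbf{Org}$ extends to a pseudo-double category (strict in the vertical direction) as follows. * Its vertical category is $\mathbf{Poly}$. Its horizontal morphisms $p\to q$ are the $[p,q]$-coalgebras, with the identities and the composition of $\mathbf{Org}$. * A square with horizontal sides $\mathcal S$ (from $p$ to $q$) and $\mathcal S'$ (from $p'$ to $q'$) and vertical sides $\phi\colon p\to p'$ and $\psi\colon q\to q'$ is a coalgebra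 map $\mathcal S;\{\psi\}\to\{\phi\};\mathcal S'$. * Identities, vertical composites and horizontal composites of squares are given by pasting lax squares in $\mathbf{Org}$. On the underlying functions $S\to S'$, vertical composition is composition and horizontal composition is the cartesian product. * The 2-cells $\mathcal S\to\mathcal S'$ of $\mathbf{Org}$ correspond bijectively, by composing with unitors, to the squares whose vertical sides are identities. This correspondence preserves identities, vertical composition and whiskering, and it takes the associators and unitors of $\mathbf{Org}$ to those of the double category. Moreover, this pseudo-double category carries a structure of monoidal pseudo-double category, given by $\otimes$ on polynomials and their maps, by $\mathcal S\otimes\mathcal S'$ on coalgebras, and by the cartesian product of underlying functions on squares. That is: coalgebras and squares form a monoidal category with unit $\{\mathrm{id}_y\}$, and horizontal source and target are strict monoidal functors to $(\mathbf{Poly},y,\otimes)$; $\otimes$ is a strong double functor, with coherent natural globular isomorphisms $(\mathcal S\otimes\mathcal S');(\mathcal T\otimes\mathcal T')\cong(\mathcal S;\mathcal T)\otimes(\mathcal S';\mathcal T')$ and $\{\mathrm{id}_{p\otimes p'}\}\cong\{\mathrm{id}_p\}\otimes\{\mathrm{id}_{p'}\}$; and the associator and unitors of $\otimes$ are transformations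 of double functors. All these structure isomorphisms are the canonical bijections between products of state sets. -/

import Mathlib

open CategoryTheory MonoidalCategory

universe u v₁ u₁ w₁ w₂

/-! ## Polynomial functors -/

/-- A polynomial `p = ∑_{I : p.A} y^{p.B I}`: `p.A` is the set of positions, and `p.B I` is the set
of directions at the position `I`. -/
abbrev PolyFunctor : Type (u + 1) := PFunctor.{u, u}

namespace PolyFunctor

/-- A map of polynomials: forward on positions, backward on directions. -/
@[ext]
structure Hom (p q : PolyFunctor.{u}) where
  onPos : p.A → q.A
  onDir : ∀ I : p.A, q.B (onPos I) → p.B I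

/-- The category of polynomials. -/
instance category : Category PolyFunctor.{u} where
  Hom := PolyFunctor.Hom
  id _ := ⟨fun I => I, fun _ i => i⟩
  comp φ ψ := ⟨fun I => ψ.onPos (φ.onPos I), fun I k => φ.onDir I (ψ.onDir (φ.onPos I) k)⟩

/-- The functor `X ↦ ∑_{I : p.A} (p.B I → X)` on sets given by a polynomial. -/
def toFunctor (p : PolyFunctor.{u}) : Type u ⥤ Type u where
  obj X := p.Obj X
  map f := ↾(p.map f)

/-- The natural transformation given by a map of polynomials. -/
def Hom.toNatTrans {p q : PolyFunctor.{u}} (φ : p ⟶ q) : toFunctor p ⟶ toFunctor q where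
  app _ := ↾(fun x => ⟨φ.onPos x.1, fun j => x.2 (φ.onDir x.1 j)⟩)

/-- Maps of polynomials are the same as natural transformations between their functors. -/
theorem Hom.toNatTrans_bijective (p q : PolyFunctor.{u}) :
    Function.Bijective (Hom.toNatTrans : (p ⟶ q) → (toFunctor p ⟶ toFunctor q)) := by
  let e (I : p.A) : (toFunctor p).obj (p.B I) := ⟨I, fun i => i⟩
  constructor
  · intro φ ψ h
    have key (I : p.A) : (⟨φ.onPos I, φ.onDir I⟩ : (J : q.A) × (q.B J → p.B I)) =
        ⟨ψ.onPos I, ψ.onDir I⟩ :=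
      congrArg (fun τ : toFunctor p ⟶ toFunctor q => τ.app (p.B I) (e I)) h
    obtain ⟨f, f'⟩ := φ
    obtain ⟨g, g'⟩ := ψ
    obtain rfl : f = g := funext fun I => congrArg Sigma.fst (key I)
    obtain rfl : f' = g' := funext fun I => eq_of_heq (Sigma.mk.inj (key I)).2
    rfl
  · intro τ
    refine ⟨⟨fun I => (τ.app _ (e I)).1, fun I => (τ.app _ (e I)).2⟩, ?_⟩
    ext X x
    exact (NatTrans.naturality_apply τ (↾x.2) (e x.1)).symm

theorem Hom.toNatTrans_id (p : PolyFunctor.{u}) : Hom.toNatTrans (𝟙 p) = 𝟙 (toFunctor p) := rfl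

theorem Hom.toNatTrans_comp {p q r : PolyFunctor.{u}} (φ : p ⟶ q) (ψ : q ⟶ r) :
    Hom.toNatTrans (φ ≫ ψ) = Hom.toNatTrans φ ≫ Hom.toNatTrans ψ := rfl

/-- The Dirichlet tensor product `p ⊗ q = ∑_{(I, J)} y^{p[I] × q[J]}`. -/
def tensor (p q : PolyFunctor.{u}) : PolyFunctor.{u} := ⟨p.A × q.A, fun I => p.B I.1 × q.B I.2⟩

/-- The Dirichlet tensor product of maps of polynomials. -/
def tensorMap {p q p' q' : PolyFunctor.{u}} (φ : p ⟶ q) (φ' : p' ⟶ q') : tensor p p' ⟶ tensor q q' :=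
  ⟨fun I => (φ.onPos I.1, φ'.onPos I.2), fun I j => (φ.onDir I.1 j.1, φ'.onDir I.2 j.2)⟩

/-- The polynomial `y`. -/
def unit : PolyFunctor.{u} := ⟨PUnit, fun _ => PUnit⟩

/-- The monoidal category of polynomials with the Dirichlet tensor product `⊗` and its unit `y`. -/
instance monoidalCategory : MonoidalCategory PolyFunctor.{u} :=
  letI : MonoidalCategoryStruct PolyFunctor.{u} :=
    { tensorObj := tensor
      whiskerLeft := fun p _ _ φ => tensorMap (𝟙 p) φ
      whiskerRight := fun φ p => tensorMap φ (𝟙 p)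
      tensorHom := tensorMap
      tensorUnit := unit
      associator := fun _ _ _ =>
        { hom := ⟨fun I => (I.1.1, (I.1.2, I.2)), fun _ i => ((i.1, i.2.1), i.2.2)⟩
          inv := ⟨fun I => ((I.1, I.2.1), I.2.2), fun _ i => (i.1.1, (i.1.2, i.2))⟩
          hom_inv_id := rfl
          inv_hom_id := rfl }
      leftUnitor := fun _ =>
        { hom := ⟨fun I => I.2, fun _ i => (⟨⟩, i)⟩
          inv := ⟨fun I => (⟨⟩, I), fun _ i => i.2⟩
          hom_inv_id := rfl
          inv_hom_id := rfl }
      rightUnitor := fun _ =>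
        { hom := ⟨fun I => I.1, fun _ i => (i, ⟨⟩)⟩
          inv := ⟨fun I => (I, ⟨⟩), fun _ i => i.1⟩
          hom_inv_id := rfl
          inv_hom_id := rfl } }
  MonoidalCategory.ofTensorHom
    (id_tensorHom_id := fun _ _ => rfl)
    (id_tensorHom := fun _ _ _ _ => rfl)
    (tensorHom_id := fun _ _ => rfl)
    (tensorHom_comp_tensorHom := fun _ _ _ _ => rfl)
    (associator_naturality := fun _ _ _ => rfl)
    (leftUnitor_naturality := fun _ => rfl)
    (rightUnitor_naturality := fun _ => rfl)
    (pentagon := fun _ _ _ _ => rfl)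
    (triangle := fun _ _ => rfl)

/-- The internal hom `[p, q] = ∑_{φ : p ⟶ q} y^{∑_I q[φ I]}` for the Dirichlet tensor product. -/
def ihom (p q : PolyFunctor.{u}) : PolyFunctor.{u} := ⟨p ⟶ q, fun φ => (I : p.A) × q.B (φ.onPos I)⟩

end PolyFunctor

/-! ## Coalgebras of internal homs and the bicategory `Org` -/

/-- `[p, q]`-coalgebras: a state set `S.V` with a function `S.str : S.V → [p, q](S.V)`. Its
morphisms are the functions that commute with the structure maps. -/
abbrev HomCoalg (p q : PolyFunctor.{u}) : Type (u + 1) :=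
  Endofunctor.Coalgebra (PolyFunctor.toFunctor (PolyFunctor.ihom p q))

namespace HomCoalg

variable {p q r p' q' : PolyFunctor.{u}}

/-- The function `[p, q](X) × [q, r](Y) → [p, r](X × Y)` given by composing the actions, and by
distributing the flow `(I, k)` to the two updates. -/
def compObj {X Y : Type u} (x : (PolyFunctor.ihom p q).Obj X) (y : (PolyFunctor.ihom q r).Obj Y) :
    (PolyFunctor.ihom p r).Obj (X × Y) :=
  ⟨(x.1 : p ⟶ q) ≫ (y.1 : q ⟶ r), fun d =>
    (x.2 ⟨d.1, y.1.onDir (x.1.onPos d.1) d.2⟩, y.2 ⟨x.1.onPos d.1, d.2⟩)⟩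

/-- The function `[p, q](X) × [p', q'](Y) → [p ⊗ p', q ⊗ q'](X × Y)` given by tensoring the actions
and updating componentwise. -/
def tensorObj {X Y : Type u} (x : (PolyFunctor.ihom p q).Obj X) (y : (PolyFunctor.ihom p' q').Obj Y) :
    (PolyFunctor.ihom (p ⊗ p') (q ⊗ q')).Obj (X × Y) :=
  ⟨(x.1 : p ⟶ q) ⊗ₘ (y.1 : p' ⟶ q'), fun d =>
    (x.2 ⟨d.1.1, d.2.1⟩, y.2 ⟨d.1.2, d.2.2⟩)⟩

/-- The state set of a coalgebra. -/
abbrev State (S : HomCoalg p q) : Type u := S.V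

/-- The function that underlies a coalgebra map. -/
abbrev fn {S T : HomCoalg p q} (f : S ⟶ T) : S.V → T.V := f.f

/-- The singleton coalgebra `{φ}`. -/
def singleton (φ : p ⟶ q) : HomCoalg p q where
  V := PUnit
  str := ↾(fun _ => ⟨φ, fun _ => ⟨⟩⟩)

/-- The composite of a `[p, q]`-coalgebra and a `[q, r]`-coalgebra. -/
def comp (S : HomCoalg p q) (T : HomCoalg q r) : HomCoalg p r where
  V := S.V × T.V
  str := ↾(fun s => compObj (S.str s.1) (T.str s.2))

/-- The Dirichlet tensor product of coalgebras. -/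
def tensor (S : HomCoalg p q) (T : HomCoalg p' q') :
    HomCoalg (p ⊗ p') (q ⊗ q') where
  V := S.V × T.V
  str := ↾(fun s => tensorObj (S.str s.1) (T.str s.2))

/-- A coalgebra map from an elementwise condition. -/
def homMk {S T : HomCoalg p q} (f : S.V → T.V)
    (h : ∀ s, (PolyFunctor.ihom p q).map f (S.str s) = T.str (f s)) : S ⟶ T where
  f := ↾f
  h := by ext s; exact h s

theorem hom_str {S T : HomCoalg p q} (f : S ⟶ T) (s : S.V) :
    (PolyFunctor.ihom p q).map f.f (S.str s) = T.str (f.f s) :=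
  types_congr_hom f.h s

/-- An isomorphism of coalgebras from a bijection. -/
def isoMk {S T : HomCoalg p q} (f : S.V ≃ T.V)
    (h : ∀ s, (PolyFunctor.ihom p q).map f (S.str s) = T.str (f s)) : S ≅ T where
  hom := homMk f h
  inv := homMk f.symm fun t => by
    obtain ⟨s, rfl⟩ := f.surjective t
    rw [← h s, f.symm_apply_apply]
    exact congrArg (fun g : S.V → S.V => (PolyFunctor.ihom p q).map g (S.str s)) f.symm_comp_self
  hom_inv_id := by ext s; exact f.symm_apply_apply s
  inv_hom_id := by ext s; exact f.apply_symm_apply s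

end HomCoalg

/-- The objects of the bicategory `Org` are polynomials. -/
structure Org : Type (u + 1) where
  poly : PolyFunctor.{u}

namespace Org

/-- The bicategory `Org`: its hom-categories are the categories of `[p, q]`-coalgebras, its
identities are the singleton coalgebras on identity maps, and composition of coalgebra maps is the
cartesian product of functions. -/
instance bicategory : Bicategory Org.{u} where
  Hom p q := HomCoalg p.poly q.poly
  id p := HomCoalg.singleton (𝟙 p.poly)
  comp S T := HomCoalg.comp S T
  homCategory _ _ := inferInstance
  whiskerLeft S _ _ η := HomCoalg.homMk (fun s => (s.1, η.f s.2)) fun s =>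
    congrArg (HomCoalg.compObj (S.str s.1)) (HomCoalg.hom_str η s.2)
  whiskerRight η T := HomCoalg.homMk (fun s => (η.f s.1, s.2)) fun s =>
    congrArg (fun x => HomCoalg.compObj x (T.str s.2)) (HomCoalg.hom_str η s.1)
  associator _ _ _ := HomCoalg.isoMk (Equiv.prodAssoc _ _ _) fun _ => rfl
  leftUnitor _ := HomCoalg.isoMk (Equiv.punitProd _) fun _ => rfl
  rightUnitor _ := HomCoalg.isoMk (Equiv.prodPUnit _) fun _ => rfl
  whiskerLeft_id _ _ := rfl
  whiskerLeft_comp _ _ _ _ _ _ := rfl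
  id_whiskerLeft _ := rfl
  comp_whiskerLeft _ _ _ _ _ := rfl
  id_whiskerRight _ _ := rfl
  comp_whiskerRight _ _ _ := rfl
  whiskerRight_id _ := rfl
  whiskerRight_comp _ _ _ := rfl
  whisker_assoc _ _ _ _ _ := rfl
  whisker_exchange _ _ := rfl
  pentagon _ _ _ _ := rfl
  triangle _ _ := rfl

end Org

/-! ## Monoidal pseudo-double categories -/

/-- The underlying cells of a pseudo-double category with vertical category `V`: horizontal
morphisms, with identities and composition, and squares

```
p  --S--> q
|φ        |ψ
v         v
p' --S'-> q'
```
-/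
structure DoubleCells (V : Type u₁) [Category.{v₁} V] where
  Hor : V → V → Type w₁
  hid (p : V) : Hor p p
  hcomp {p q r : V} : Hor p q → Hor q r → Hor p r
  Sq {p q p' q' : V} : Hor p q → Hor p' q' → (p ⟶ p') → (q ⟶ q') → Type w₂

section

variable {V : Type u₁} [Category.{v₁} V]

/-- The category of horizontal morphisms and squares, under vertical composition. The vertical
boundaries of the two sides of an equation of squares may agree only up to a (provable) equation in
`V`, hence the heterogeneous equalities. -/
structure SquareCategory (C : DoubleCells.{v₁, u₁, w₁, w₂} V) where
  vid {p q : V} (S : C.Hor p q) : C.Sq S S (𝟙 p) (𝟙 q)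
  vcomp {p q p' q' p'' q'' : V} {S : C.Hor p q} {S' : C.Hor p' q'} {S'' : C.Hor p'' q''}
    {φ : p ⟶ p'} {ψ : q ⟶ q'} {φ' : p' ⟶ p''} {ψ' : q' ⟶ q''} :
    C.Sq S S' φ ψ → C.Sq S' S'' φ' ψ' → C.Sq S S'' (φ ≫ φ') (ψ ≫ ψ')
  vid_vcomp {p q p' q' : V} {S : C.Hor p q} {S' : C.Hor p' q'} {φ : p ⟶ p'} {ψ : q ⟶ q'}
    (a : C.Sq S S' φ ψ) : vcomp (vid S) a ≍ a
  vcomp_vid {p q p' q' : V} {S : C.Hor p q} {S' : C.Hor p' q'} {φ : p ⟶ p'} {ψ : q ⟶ q'}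
    (a : C.Sq S S' φ ψ) : vcomp a (vid S') ≍ a
  vcomp_assoc {p q p' q' p'' q'' x y : V} {S : C.Hor p q} {S' : C.Hor p' q'}
    {S'' : C.Hor p'' q''} {T : C.Hor x y} {φ : p ⟶ p'} {ψ : q ⟶ q'} {φ' : p' ⟶ p''}
    {ψ' : q' ⟶ q''} {φ'' : p'' ⟶ x} {ψ'' : q'' ⟶ y}
    (a : C.Sq S S' φ ψ) (b : C.Sq S' S'' φ' ψ') (c : C.Sq S'' T φ'' ψ'') :
    vcomp (vcomp a b) c ≍ vcomp a (vcomp b c)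

/-- A vertically invertible square over vertical isomorphisms `e` and `e'`. -/
structure SquareCategory.VIso {C : DoubleCells.{v₁, u₁, w₁, w₂} V} (D : SquareCategory C)
    {p q p' q' : V} (S : C.Hor p q) (S' : C.Hor p' q') (e : p ≅ p') (e' : q ≅ q') where
  hom : C.Sq S S' e.hom e'.hom
  inv : C.Sq S' S e.inv e'.inv
  hom_inv : D.vcomp hom inv ≍ D.vid S
  inv_hom : D.vcomp inv hom ≍ D.vid S'

/-- A globular isomorphism: a vertically invertible square over identities. -/
abbrev SquareCategory.GlobIso {C : DoubleCells.{v₁, u₁, w₁, w₂} V} (D : SquareCategory C)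
    {p q : V} (S S' : C.Hor p q) :=
  D.VIso S S' (Iso.refl p) (Iso.refl q)

/-- The structure of a pseudo-double category on given cells: vertical composition is strictly
associative and unital; horizontal composition is functorial for squares, and it is associative and
unital up to coherent natural globular isomorphisms. -/
structure PseudoDoubleCategory (C : DoubleCells.{v₁, u₁, w₁, w₂} V) extends SquareCategory C where
  /-- Horizontal identity squares. -/
  hidSq {p p' : V} (φ : p ⟶ p') : C.Sq (C.hid p) (C.hid p') φ φ
  /-- Horizontal composition of squares. -/
  hcompSq {p q r p' q' r' : V} {S : C.Hor p q} {T : C.Hor q r} {S' : C.Hor p' q'}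
    {T' : C.Hor q' r'} {φ : p ⟶ p'} {ψ : q ⟶ q'} {χ : r ⟶ r'} :
    C.Sq S S' φ ψ → C.Sq T T' ψ χ → C.Sq (C.hcomp S T) (C.hcomp S' T') φ χ
  hidSq_id (p : V) : hidSq (𝟙 p) = vid (C.hid p)
  hidSq_comp {p p' p'' : V} (φ : p ⟶ p') (φ' : p' ⟶ p'') :
    hidSq (φ ≫ φ') = vcomp (hidSq φ) (hidSq φ')
  hcompSq_vid {p q r : V} (S : C.Hor p q) (T : C.Hor q r) :
    hcompSq (vid S) (vid T) = vid (C.hcomp S T)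
  hcompSq_vcomp {p q r p' q' r' p'' q'' r'' : V} {S : C.Hor p q} {T : C.Hor q r}
    {S' : C.Hor p' q'} {T' : C.Hor q' r'} {S'' : C.Hor p'' q''} {T'' : C.Hor q'' r''}
    {φ : p ⟶ p'} {ψ : q ⟶ q'} {χ : r ⟶ r'} {φ' : p' ⟶ p''} {ψ' : q' ⟶ q''} {χ' : r' ⟶ r''}
    (a : C.Sq S S' φ ψ) (a' : C.Sq S' S'' φ' ψ') (b : C.Sq T T' ψ χ) (b' : C.Sq T' T'' ψ' χ') :
    hcompSq (vcomp a a') (vcomp b b') = vcomp (hcompSq a b) (hcompSq a' b')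
  assoc {p q r s : V} (S : C.Hor p q) (T : C.Hor q r) (U : C.Hor r s) :
    toSquareCategory.GlobIso (C.hcomp (C.hcomp S T) U) (C.hcomp S (C.hcomp T U))
  leftUnitor {p q : V} (S : C.Hor p q) : toSquareCategory.GlobIso (C.hcomp (C.hid p) S) S
  rightUnitor {p q : V} (S : C.Hor p q) : toSquareCategory.GlobIso (C.hcomp S (C.hid q)) S
  assoc_naturality {p q r s p' q' r' s' : V} {S : C.Hor p q} {T : C.Hor q r} {U : C.Hor r s}
    {S' : C.Hor p' q'} {T' : C.Hor q' r'} {U' : C.Hor r' s'} {φ : p ⟶ p'} {ψ : q ⟶ q'}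
    {χ : r ⟶ r'} {ω : s ⟶ s'} (a : C.Sq S S' φ ψ) (b : C.Sq T T' ψ χ) (c : C.Sq U U' χ ω) :
    vcomp (hcompSq (hcompSq a b) c) (assoc S' T' U').hom ≍
      vcomp (assoc S T U).hom (hcompSq a (hcompSq b c))
  leftUnitor_naturality {p q p' q' : V} {S : C.Hor p q} {S' : C.Hor p' q'} {φ : p ⟶ p'}
    {ψ : q ⟶ q'} (a : C.Sq S S' φ ψ) :
    vcomp (hcompSq (hidSq φ) a) (leftUnitor S').hom ≍ vcomp (leftUnitor S).hom a
  rightUnitor_naturality {p q p' q' : V} {S : C.Hor p q} {S' : C.Hor p' q'} {φ : p ⟶ p'}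
    {ψ : q ⟶ q'} (a : C.Sq S S' φ ψ) :
    vcomp (hcompSq a (hidSq ψ)) (rightUnitor S').hom ≍ vcomp (rightUnitor S).hom a
  pentagon {p q r s t : V} (S : C.Hor p q) (T : C.Hor q r) (U : C.Hor r s) (W : C.Hor s t) :
    vcomp (vcomp (hcompSq (assoc S T U).hom (vid W)) (assoc S (C.hcomp T U) W).hom)
        (hcompSq (vid S) (assoc T U W).hom) ≍
      vcomp (assoc (C.hcomp S T) U W).hom (assoc S T (C.hcomp U W)).hom
  triangle {p q r : V} (S : C.Hor p q) (T : C.Hor q r) :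
    vcomp (assoc S (C.hid q) T).hom (hcompSq (vid S) (leftUnitor T).hom) ≍
      hcompSq (rightUnitor S).hom (vid T)

variable [MonoidalCategory V]

/-- The structure of a monoidal pseudo-double category on a pseudo-double category `D` whose
vertical category `V` is monoidal, with a given tensor product `tens` of horizontal morphisms:
horizontal morphisms and squares form a monoidal category with unit `hid (𝟙_ V)`, and source and
target are strict monoidal functors to `V`; `⊗` is a (strong) double functor, through coherent
natural globular isomorphisms `interchange` and `unitInterchange`; and the associators and unitors
of `⊗` are transformations of double functors. -/
structure MonoidalDoubleStructure {C : DoubleCells.{v₁, u₁, w₁, w₂} V} (D : PseudoDoubleCategory C)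
    (tens : ∀ {p q p' q' : V}, C.Hor p q → C.Hor p' q' → C.Hor (p ⊗ p') (q ⊗ q')) where
  /-- The tensor product of squares. -/
  tensSq {p q p' q' r s r' s' : V} {S : C.Hor p q} {S' : C.Hor p' q'} {T : C.Hor r s}
    {T' : C.Hor r' s'} {φ : p ⟶ p'} {ψ : q ⟶ q'} {χ : r ⟶ r'} {ω : s ⟶ s'} :
    C.Sq S S' φ ψ → C.Sq T T' χ ω → C.Sq (tens S T) (tens S' T') (φ ⊗ₘ χ) (ψ ⊗ₘ ω)
  -- the tensor product is a functor on the category of squares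
  tensSq_vid {p q r s : V} (S : C.Hor p q) (T : C.Hor r s) :
    tensSq (D.vid S) (D.vid T) ≍ D.vid (tens S T)
  tensSq_vcomp {p q p' q' p'' q'' r s r' s' r'' s'' : V} {S : C.Hor p q} {S' : C.Hor p' q'}
    {S'' : C.Hor p'' q''} {T : C.Hor r s} {T' : C.Hor r' s'} {T'' : C.Hor r'' s''}
    {φ : p ⟶ p'} {ψ : q ⟶ q'} {φ' : p' ⟶ p''} {ψ' : q' ⟶ q''}
    {χ : r ⟶ r'} {ω : s ⟶ s'} {χ' : r' ⟶ r''} {ω' : s' ⟶ s''}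
    (a : C.Sq S S' φ ψ) (a' : C.Sq S' S'' φ' ψ') (b : C.Sq T T' χ ω) (b' : C.Sq T' T'' χ' ω') :
    tensSq (D.vcomp a a') (D.vcomp b b') ≍ D.vcomp (tensSq a b) (tensSq a' b')
  -- the monoidal category of horizontal morphisms and squares
  tensAssoc {p q r s t z : V} (S : C.Hor p q) (T : C.Hor r s) (U : C.Hor t z) :
    D.VIso (tens (tens S T) U) (tens S (tens T U)) (α_ p r t) (α_ q s z)
  tensLeftUnitor {p q : V} (S : C.Hor p q) :
    D.VIso (tens (C.hid (𝟙_ V)) S) S (λ_ p) (λ_ q)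
  tensRightUnitor {p q : V} (S : C.Hor p q) :
    D.VIso (tens S (C.hid (𝟙_ V))) S (ρ_ p) (ρ_ q)
  tensAssoc_naturality {p q r s t z p' q' r' s' t' z' : V} {S : C.Hor p q} {T : C.Hor r s}
    {U : C.Hor t z} {S' : C.Hor p' q'} {T' : C.Hor r' s'} {U' : C.Hor t' z'}
    {φ : p ⟶ p'} {ψ : q ⟶ q'} {φ' : r ⟶ r'} {ψ' : s ⟶ s'} {φ'' : t ⟶ t'} {ψ'' : z ⟶ z'}
    (a : C.Sq S S' φ ψ) (b : C.Sq T T' φ' ψ') (c : C.Sq U U' φ'' ψ'') :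
    D.vcomp (tensSq (tensSq a b) c) (tensAssoc S' T' U').hom ≍
      D.vcomp (tensAssoc S T U).hom (tensSq a (tensSq b c))
  tensLeftUnitor_naturality {p q p' q' : V} {S : C.Hor p q} {S' : C.Hor p' q'} {φ : p ⟶ p'}
    {ψ : q ⟶ q'} (a : C.Sq S S' φ ψ) :
    D.vcomp (tensSq (D.vid (C.hid (𝟙_ V))) a) (tensLeftUnitor S').hom ≍
      D.vcomp (tensLeftUnitor S).hom a
  tensRightUnitor_naturality {p q p' q' : V} {S : C.Hor p q} {S' : C.Hor p' q'} {φ : p ⟶ p'}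
    {ψ : q ⟶ q'} (a : C.Sq S S' φ ψ) :
    D.vcomp (tensSq a (D.vid (C.hid (𝟙_ V)))) (tensRightUnitor S').hom ≍
      D.vcomp (tensRightUnitor S).hom a
  tens_pentagon {p q p' q' p'' q'' x y : V} (S : C.Hor p q) (S' : C.Hor p' q')
    (S'' : C.Hor p'' q'') (T : C.Hor x y) :
    D.vcomp (D.vcomp (tensSq (tensAssoc S S' S'').hom (D.vid T))
        (tensAssoc S (tens S' S'') T).hom) (tensSq (D.vid S) (tensAssoc S' S'' T).hom) ≍
      D.vcomp (tensAssoc (tens S S') S'' T).hom (tensAssoc S S' (tens S'' T)).hom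
  tens_triangle {p q p' q' : V} (S : C.Hor p q) (S' : C.Hor p' q') :
    D.vcomp (tensAssoc S (C.hid (𝟙_ V)) S').hom (tensSq (D.vid S) (tensLeftUnitor S').hom) ≍
      tensSq (tensRightUnitor S).hom (D.vid S')
  -- the tensor product is a double functor
  interchange {p q r p' q' r' : V} (S : C.Hor p q) (T : C.Hor q r) (S' : C.Hor p' q')
    (T' : C.Hor q' r') :
    D.GlobIso (C.hcomp (tens S S') (tens T T')) (tens (C.hcomp S T) (C.hcomp S' T'))
  unitInterchange (p p' : V) : D.GlobIso (C.hid (p ⊗ p')) (tens (C.hid p) (C.hid p'))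
  interchange_naturality {p q r p' q' r' x y z x' y' z' : V}
    {S : C.Hor p q} {T : C.Hor q r} {S' : C.Hor p' q'} {T' : C.Hor q' r'}
    {A : C.Hor x y} {B : C.Hor y z} {A' : C.Hor x' y'} {B' : C.Hor y' z'}
    {φ : p ⟶ x} {ψ : q ⟶ y} {χ : r ⟶ z} {φ' : p' ⟶ x'} {ψ' : q' ⟶ y'} {χ' : r' ⟶ z'}
    (a : C.Sq S A φ ψ) (b : C.Sq T B ψ χ) (a' : C.Sq S' A' φ' ψ') (b' : C.Sq T' B' ψ' χ') :
    D.vcomp (D.hcompSq (tensSq a a') (tensSq b b')) (interchange A B A' B').hom ≍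
      D.vcomp (interchange S T S' T').hom (tensSq (D.hcompSq a b) (D.hcompSq a' b'))
  unitInterchange_naturality {p p' x x' : V} (φ : p ⟶ x) (φ' : p' ⟶ x') :
    D.vcomp (D.hidSq (φ ⊗ₘ φ')) (unitInterchange x x').hom ≍
      D.vcomp (unitInterchange p p').hom (tensSq (D.hidSq φ) (D.hidSq φ'))
  interchange_assoc {p q r s p' q' r' s' : V} (S : C.Hor p q) (T : C.Hor q r) (U : C.Hor r s)
    (S' : C.Hor p' q') (T' : C.Hor q' r') (U' : C.Hor r' s') :
    D.vcomp (D.vcomp (D.hcompSq (interchange S T S' T').hom (D.vid (tens U U')))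
        (interchange (C.hcomp S T) U (C.hcomp S' T') U').hom)
        (tensSq (D.assoc S T U).hom (D.assoc S' T' U').hom) ≍
      D.vcomp (D.vcomp (D.assoc (tens S S') (tens T T') (tens U U')).hom
        (D.hcompSq (D.vid (tens S S')) (interchange T U T' U').hom))
        (interchange S (C.hcomp T U) S' (C.hcomp T' U')).hom
  interchange_leftUnitor {p q p' q' : V} (S : C.Hor p q) (S' : C.Hor p' q') :
    D.vcomp (D.vcomp (D.hcompSq (unitInterchange p p').hom (D.vid (tens S S')))
        (interchange (C.hid p) S (C.hid p') S').hom)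
        (tensSq (D.leftUnitor S).hom (D.leftUnitor S').hom) ≍
      (D.leftUnitor (tens S S')).hom
  interchange_rightUnitor {p q p' q' : V} (S : C.Hor p q) (S' : C.Hor p' q') :
    D.vcomp (D.vcomp (D.hcompSq (D.vid (tens S S')) (unitInterchange q q').hom)
        (interchange S (C.hid q) S' (C.hid q')).hom)
        (tensSq (D.rightUnitor S).hom (D.rightUnitor S').hom) ≍
      (D.rightUnitor (tens S S')).hom
  -- the associator of the tensor product is a transformation of double functors
  tensAssoc_hcomp {p q r p' q' r' p'' q'' r'' : V} (S : C.Hor p q) (T : C.Hor q r)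
    (S' : C.Hor p' q') (T' : C.Hor q' r') (S'' : C.Hor p'' q'') (T'' : C.Hor q'' r'') :
    D.vcomp (D.vcomp (D.hcompSq (tensAssoc S S' S'').hom (tensAssoc T T' T'').hom)
        (interchange S T (tens S' S'') (tens T' T'')).hom)
        (tensSq (D.vid (C.hcomp S T)) (interchange S' T' S'' T'').hom) ≍
      D.vcomp (D.vcomp (interchange (tens S S') (tens T T') S'' T'').hom
        (tensSq (interchange S T S' T').hom (D.vid (C.hcomp S'' T''))))
        (tensAssoc (C.hcomp S T) (C.hcomp S' T') (C.hcomp S'' T'')).hom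
  tensAssoc_hid (p p' p'' : V) :
    D.vcomp (D.vcomp (D.hidSq (α_ p p' p'').hom) (unitInterchange p (p' ⊗ p'')).hom)
        (tensSq (D.vid (C.hid p)) (unitInterchange p' p'').hom) ≍
      D.vcomp (D.vcomp (unitInterchange (p ⊗ p') p'').hom
        (tensSq (unitInterchange p p').hom (D.vid (C.hid p''))))
        (tensAssoc (C.hid p) (C.hid p') (C.hid p'')).hom
  -- the unitors of the tensor product are transformations of double functors
  tensLeftUnitor_hcomp {p q r : V} (S : C.Hor p q) (T : C.Hor q r) :
    D.vcomp (D.vcomp (interchange (C.hid (𝟙_ V)) (C.hid (𝟙_ V)) S T).hom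
        (tensSq (D.leftUnitor (C.hid (𝟙_ V))).hom (D.vid (C.hcomp S T))))
        (tensLeftUnitor (C.hcomp S T)).hom ≍
      D.hcompSq (tensLeftUnitor S).hom (tensLeftUnitor T).hom
  tensLeftUnitor_hid (p : V) :
    D.vcomp (unitInterchange (𝟙_ V) p).hom (tensLeftUnitor (C.hid p)).hom ≍
      D.hidSq (λ_ p).hom
  tensRightUnitor_hcomp {p q r : V} (S : C.Hor p q) (T : C.Hor q r) :
    D.vcomp (D.vcomp (interchange S T (C.hid (𝟙_ V)) (C.hid (𝟙_ V))).hom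
        (tensSq (D.vid (C.hcomp S T)) (D.leftUnitor (C.hid (𝟙_ V))).hom))
        (tensRightUnitor (C.hcomp S T)).hom ≍
      D.hcompSq (tensRightUnitor S).hom (tensRightUnitor T).hom
  tensRightUnitor_hid (p : V) :
    D.vcomp (unitInterchange p (𝟙_ V)).hom (tensRightUnitor (C.hid p)).hom ≍
      D.hidSq (ρ_ p).hom

end

/-! ## The cells of the double category `Org` -/

namespace Org

open Bicategory

variable {p q r p' q' r' p'' q'' : PolyFunctor.{u}}

/-- The state set of a coalgebra. -/
abbrev State (S : mk p ⟶ mk q) : Type u := HomCoalg.State S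

/-- A map of polynomials `φ`, seen as the singleton coalgebra `{φ}`. -/
def single (φ : p ⟶ q) : mk p ⟶ mk q := HomCoalg.singleton φ

/-- The isomorphism `{φ ≫ ψ} ≅ {φ} ≫ {ψ}` of one-state coalgebras. -/
def singleComp (φ : p ⟶ q) (ψ : q ⟶ r) : single (φ ≫ ψ) ≅ single φ ≫ single ψ :=
  HomCoalg.isoMk (Equiv.punitProd PUnit).symm fun _ => rfl

/-- A square from `S` to `S'` with vertical boundaries `φ` and `ψ`: a coalgebra map from `S ; {ψ}`
to `{φ} ; S'`. -/
def Square (S : mk p ⟶ mk q) (S' : mk p' ⟶ mk q') (φ : p ⟶ p') (ψ : q ⟶ q') : Type u :=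
  (S ≫ single ψ) ⟶ (single φ ≫ S')

/-- The cells of the double category `Org`: horizontal morphisms are coalgebras, with the identities
and the composition of the bicategory `Org`. -/
abbrev cells : DoubleCells.{u, u + 1, u + 1, u} PolyFunctor.{u} where
  Hor p q := mk p ⟶ mk q
  hid p := 𝟙 (mk p)
  hcomp S T := S ≫ T
  Sq S S' φ ψ := Square S S' φ ψ

/-- The Dirichlet tensor product of horizontal morphisms. -/
def tens (S : mk p ⟶ mk q) (S' : mk p' ⟶ mk q') : mk (p ⊗ p') ⟶ mk (q ⊗ q') :=
  HomCoalg.tensor S S'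

namespace Square

/-- The function between the state sets that underlies a square. -/
def fn {S : mk p ⟶ mk q} {S' : mk p' ⟶ mk q'} {φ : p ⟶ p'} {ψ : q ⟶ q'}
    (a : Square S S' φ ψ) (s : State S) : State S' :=
  (HomCoalg.fn a (s, PUnit.unit)).2

/-- The globular square given by a 2-cell of the bicategory `Org`. -/
def ofTwoCell {S S' : mk p ⟶ mk q} (f : S ⟶ S') : Square S S' (𝟙 p) (𝟙 q) :=
  (Bicategory.rightUnitor S).hom ≫ f ≫ (Bicategory.leftUnitor S').inv

/-- Vertical pasting of lax squares in the bicategory `Org`. -/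
def vpaste {S : mk p ⟶ mk q} {S' : mk p' ⟶ mk q'} {S'' : mk p'' ⟶ mk q''}
    {φ : p ⟶ p'} {ψ : q ⟶ q'} {φ' : p' ⟶ p''} {ψ' : q' ⟶ q''}
    (a : Square S S' φ ψ) (b : Square S' S'' φ' ψ') : Square S S'' (φ ≫ φ') (ψ ≫ ψ') :=
  S ◁ (singleComp ψ ψ').hom ≫ (Bicategory.associator S (single ψ) (single ψ')).inv ≫
    Bicategory.whiskerRight (show S ≫ single ψ ⟶ single φ ≫ S' from a) (single ψ') ≫
    (Bicategory.associator (single φ) S' (single ψ')).hom ≫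
    Bicategory.whiskerLeft (single φ) (show S' ≫ single ψ' ⟶ single φ' ≫ S'' from b) ≫
    (Bicategory.associator (single φ) (single φ') S'').inv ≫ (singleComp φ φ').inv ▷ S''

/-- Horizontal pasting of lax squares in the bicategory `Org`. -/
def hpaste {S : mk p ⟶ mk q} {T : mk q ⟶ mk r} {S' : mk p' ⟶ mk q'} {T' : mk q' ⟶ mk r'}
    {φ : p ⟶ p'} {ψ : q ⟶ q'} {χ : r ⟶ r'}
    (a : Square S S' φ ψ) (b : Square T T' ψ χ) : Square (S ≫ T) (S' ≫ T') φ χ :=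
  (Bicategory.associator S T (single χ)).hom ≫
    Bicategory.whiskerLeft S (show T ≫ single χ ⟶ single ψ ≫ T' from b) ≫
    (Bicategory.associator S (single ψ) T').inv ≫
    Bicategory.whiskerRight (show S ≫ single ψ ⟶ single φ ≫ S' from a) T' ≫
    (Bicategory.associator (single φ) S' T').hom

/-- The lax square on a vertical morphism whose horizontal sides are identities. -/
def hrefl (φ : p ⟶ p') : Square (𝟙 (mk p)) (𝟙 (mk p')) φ φ :=
  (Bicategory.leftUnitor (single φ)).hom ≫ (Bicategory.rightUnitor (single φ)).inv

end Square

open Square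

/-- The pseudo-double category structure `D` extends the bicategory `Org`: the 2-cells of `Org` are
the globular squares of `D`, with the composition, the associators and the unitors of `Org`, and all
composites of squares are given by pasting in `Org`. On underlying functions, vertical composition of
squares is composition and horizontal composition is the cartesian product. -/
structure ExtendsBicategory (D : PseudoDoubleCategory cells.{u}) : Prop where
  ofTwoCell_bijective {p q : PolyFunctor.{u}} (S S' : mk p ⟶ mk q) :
    Function.Bijective (ofTwoCell : (S ⟶ S') → Square S S' (𝟙 p) (𝟙 q))
  ofTwoCell_id {p q : PolyFunctor.{u}} (S : mk p ⟶ mk q) : ofTwoCell (𝟙 S) = D.vid S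
  ofTwoCell_comp {p q : PolyFunctor.{u}} {S S' S'' : mk p ⟶ mk q} (f : S ⟶ S') (g : S' ⟶ S'') :
    ofTwoCell (f ≫ g) ≍ D.vcomp (ofTwoCell f) (ofTwoCell g)
  ofTwoCell_whiskerLeft {p q r : PolyFunctor.{u}} (S : mk p ⟶ mk q) {T T' : mk q ⟶ mk r}
    (f : T ⟶ T') : ofTwoCell (S ◁ f) = D.hcompSq (D.vid S) (ofTwoCell f)
  ofTwoCell_whiskerRight {p q r : PolyFunctor.{u}} {S S' : mk p ⟶ mk q} (f : S ⟶ S')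
    (T : mk q ⟶ mk r) : ofTwoCell (f ▷ T) = D.hcompSq (ofTwoCell f) (D.vid T)
  ofTwoCell_associator {p q r s : PolyFunctor.{u}} (S : mk p ⟶ mk q) (T : mk q ⟶ mk r)
    (U : mk r ⟶ mk s) : ofTwoCell (Bicategory.associator S T U).hom = (D.assoc S T U).hom
  ofTwoCell_leftUnitor {p q : PolyFunctor.{u}} (S : mk p ⟶ mk q) :
    ofTwoCell (Bicategory.leftUnitor S).hom = (D.leftUnitor S).hom
  ofTwoCell_rightUnitor {p q : PolyFunctor.{u}} (S : mk p ⟶ mk q) :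
    ofTwoCell (Bicategory.rightUnitor S).hom = (D.rightUnitor S).hom
  vcomp_eq {p q p' q' p'' q'' : PolyFunctor.{u}} {S : mk p ⟶ mk q} {S' : mk p' ⟶ mk q'}
    {S'' : mk p'' ⟶ mk q''} {φ : p ⟶ p'} {ψ : q ⟶ q'} {φ' : p' ⟶ p''} {ψ' : q' ⟶ q''}
    (a : Square S S' φ ψ) (b : Square S' S'' φ' ψ') : D.vcomp a b = vpaste a b
  hcompSq_eq {p q r p' q' r' : PolyFunctor.{u}} {S : mk p ⟶ mk q} {T : mk q ⟶ mk r}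
    {S' : mk p' ⟶ mk q'} {T' : mk q' ⟶ mk r'} {φ : p ⟶ p'} {ψ : q ⟶ q'} {χ : r ⟶ r'}
    (a : Square S S' φ ψ) (b : Square T T' ψ χ) : D.hcompSq a b = hpaste a b
  hidSq_eq {p p' : PolyFunctor.{u}} (φ : p ⟶ p') : D.hidSq φ = hrefl φ
  fn_vcomp {p q p' q' p'' q'' : PolyFunctor.{u}} {S : mk p ⟶ mk q} {S' : mk p' ⟶ mk q'}
    {S'' : mk p'' ⟶ mk q''} {φ : p ⟶ p'} {ψ : q ⟶ q'} {φ' : p' ⟶ p''} {ψ' : q' ⟶ q''}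
    (a : Square S S' φ ψ) (b : Square S' S'' φ' ψ') (s : State S) :
    fn (D.vcomp a b) s = fn b (fn a s)
  fn_hcompSq {p q r p' q' r' : PolyFunctor.{u}} {S : mk p ⟶ mk q} {T : mk q ⟶ mk r}
    {S' : mk p' ⟶ mk q'} {T' : mk q' ⟶ mk r'} {φ : p ⟶ p'} {ψ : q ⟶ q'} {χ : r ⟶ r'}
    (a : Square S S' φ ψ) (b : Square T T' ψ χ) (s : State S) (t : State T) :
    fn (D.hcompSq a b) (s, t) = (fn a s, fn b t)

/-- The monoidal structure `M` is induced by the Dirichlet tensor product: on underlying functions,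
the tensor product of squares is the cartesian product, and the structure isomorphisms are the
canonical bijections between cartesian products of state sets. -/
structure IsDirichlet {D : PseudoDoubleCategory cells.{u}} (M : MonoidalDoubleStructure D tens) :
    Prop where
  fn_tensSq {p q p' q' r s r' s' : PolyFunctor.{u}} {S : mk p ⟶ mk q} {S' : mk p' ⟶ mk q'}
    {T : mk r ⟶ mk s} {T' : mk r' ⟶ mk s'} {φ : p ⟶ p'} {ψ : q ⟶ q'} {χ : r ⟶ r'} {ω : s ⟶ s'}
    (a : Square S S' φ ψ) (b : Square T T' χ ω) (x : State S) (y : State T) :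
    fn (M.tensSq a b) (x, y) = (fn a x, fn b y)
  fn_tensAssoc {p q r s t z : PolyFunctor.{u}} (S : mk p ⟶ mk q) (T : mk r ⟶ mk s)
    (U : mk t ⟶ mk z) (x : State S) (y : State T) (w : State U) :
    fn (M.tensAssoc S T U).hom ((x, y), w) = (x, (y, w))
  fn_tensLeftUnitor {p q : PolyFunctor.{u}} (S : mk p ⟶ mk q) (x : State S) :
    fn (M.tensLeftUnitor S).hom (PUnit.unit, x) = x
  fn_tensRightUnitor {p q : PolyFunctor.{u}} (S : mk p ⟶ mk q) (x : State S) :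
    fn (M.tensRightUnitor S).hom (x, PUnit.unit) = x
  fn_interchange {p q r p' q' r' : PolyFunctor.{u}} (S : mk p ⟶ mk q) (T : mk q ⟶ mk r)
    (S' : mk p' ⟶ mk q') (T' : mk q' ⟶ mk r') (x : State S) (x' : State S') (y : State T)
    (y' : State T') :
    fn (M.interchange S T S' T').hom ((x, x'), (y, y')) = ((x, y), (x', y'))
  fn_unitInterchange (p p' : PolyFunctor.{u}) :
    fn (M.unitInterchange p p').hom PUnit.unit = (PUnit.unit, PUnit.unit)

end Org

/-!
A square from `S` to `S'` is a coalgebra map `S ; {ψ} ⟶ {φ} ; S'`, and since `{ψ}` and `{φ}` have a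
single state, it is determined by its underlying function `State S → State S'`. Hence an equation
between squares is an equation between functions, provided that the vertical sides agree
(`Org.Square.heq_of_fn`). On underlying functions, vertical pasting is composition, horizontal
pasting and the tensor product are the cartesian product, and the structure isomorphisms are the
canonical bijections of products. So every law of a monoidal pseudo-double category reduces to an
identity between functions on products of sets, which holds definitionally by the eta rules for
pairs and for the one-point set; likewise, the equations between the vertical sides hold
definitionally, because maps of polynomials compose by composing functions on positions and on
directions, and the coherence maps of `⊗` on `Poly` only rearrange pairs of these.

What remains is the existence of the squares. Pasting in `Org` provides the identities and both
composites; invertible 2-cells of `Org` provide the globular isomorphisms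
(`Org.globIsoOfIso`); and `Org.Square.tensor` shows that the product of the functions underlying two
squares is again a square.
-/

namespace Org.Square

variable {p q r s p' q' r' s' : PolyFunctor.{u}}

/-- Two squares with the same horizontal sides and provably equal vertical sides agree as soon as
their underlying functions do. -/
theorem heq_of_fn {S : mk p ⟶ mk q} {S' : mk p' ⟶ mk q'} {φ φ' : p ⟶ p'} {ψ ψ' : q ⟶ q'}
    {a : Square S S' φ ψ} {b : Square S S' φ' ψ'} (hφ : φ = φ') (hψ : ψ = ψ')
    (h : ∀ x, fn a x = fn b x) : a ≍ b := by
  subst hφ hψ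
  refine heq_of_eq (Endofunctor.Coalgebra.Hom.ext ?_)
  ext x
  exact Prod.ext rfl (h x.1)

theorem ext_fn {S : mk p ⟶ mk q} {S' : mk p' ⟶ mk q'} {φ : p ⟶ p'} {ψ : q ⟶ q'}
    {a b : Square S S' φ ψ} (h : ∀ x, fn a x = fn b x) : a = b :=
  eq_of_heq (heq_of_fn rfl rfl h)

/-- A square from a function `f` between state sets: on the state sets of `S ; {ψ}` and `{φ} ; S'`
it is `(x, *) ↦ (*, f x)`, and the elementwise condition says that this is a coalgebra map. -/
def ofFn {S : mk p ⟶ mk q} {S' : mk p' ⟶ mk q'} {φ : p ⟶ p'} {ψ : q ⟶ q'}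
    (f : State S → State S')
    (h : ∀ x : State S, (PolyFunctor.ihom p q').map (fun y => (PUnit.unit, f y.1))
      ((HomCoalg.comp S (HomCoalg.singleton ψ)).str (x, PUnit.unit)) =
      (HomCoalg.comp (HomCoalg.singleton φ) S').str (PUnit.unit, f x)) : Square S S' φ ψ :=
  HomCoalg.homMk (fun y => (PUnit.unit, f y.1)) fun y => h y.1

/-- The singleton coalgebra on an identity map is the identity of `Org`, so a square between
vertical identities becomes a 2-cell by composing with the unitors the other way round. -/
theorem ofTwoCell_bijective (S S' : mk p ⟶ mk q) :
    Function.Bijective (ofTwoCell : (S ⟶ S') → Square S S' (𝟙 p) (𝟙 q)) := by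
  refine ⟨fun f g h => ?_, fun a => ⟨(Bicategory.rightUnitor S).inv ≫
    (show S ≫ 𝟙 (mk q) ⟶ 𝟙 (mk p) ≫ S' from a) ≫ (Bicategory.leftUnitor S').hom,
    ext_fn fun _ => rfl⟩⟩
  refine Endofunctor.Coalgebra.Hom.ext ?_
  ext x
  exact congrArg (fun c => fn c x) h

/-- The tensor product of squares, with the cartesian product as its underlying function. It is a
coalgebra map because tensoring, followed by the bijection that merges the two one-point factors into
one, takes the elementwise conditions on the two squares to the one on their product. -/
def tensor {S : mk p ⟶ mk q} {S' : mk p' ⟶ mk q'} {T : mk r ⟶ mk s} {T' : mk r' ⟶ mk s'}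
    {φ : p ⟶ p'} {ψ : q ⟶ q'} {χ : r ⟶ r'} {ω : s ⟶ s'}
    (a : Square S S' φ ψ) (b : Square T T' χ ω) :
    Square (tens S T) (tens S' T') (φ ⊗ₘ χ) (ψ ⊗ₘ ω) :=
  ofFn (fun x => (fn a x.1, fn b x.2)) fun x =>
    congrArg₂ (fun u v => (PolyFunctor.ihom (p ⊗ r) (q' ⊗ s')).map
        (fun y : (PUnit × State S') × (PUnit × State T') => (PUnit.unit, (y.1.2, y.2.2)))
        (HomCoalg.tensorObj u v))
      (HomCoalg.hom_str a (x.1, PUnit.unit)) (HomCoalg.hom_str b (x.2, PUnit.unit))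

end Org.Square

namespace Org

open Square

/-- Coalgebras and squares under vertical pasting. The identity squares are those of the identity
2-cells. -/
def squareCategory : SquareCategory cells.{u} where
  vid S := ofTwoCell (𝟙 S)
  vcomp a b := vpaste a b
  vid_vcomp _ := heq_of_fn rfl rfl fun _ => rfl
  vcomp_vid _ := heq_of_fn rfl rfl fun _ => rfl
  vcomp_assoc _ _ _ := heq_of_fn rfl rfl fun _ => rfl

/-- The globular isomorphism given by an invertible 2-cell of the bicategory `Org`. -/
def globIsoOfIso {p q : PolyFunctor.{u}} {S S' : mk p ⟶ mk q} (e : S ≅ S') :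
    squareCategory.{u}.GlobIso S S' where
  hom := ofTwoCell e.hom
  inv := ofTwoCell e.inv
  hom_inv := heq_of_fn rfl rfl fun x => congrArg (fun f => HomCoalg.fn f x) e.hom_inv_id
  inv_hom := heq_of_fn rfl rfl fun x => congrArg (fun f => HomCoalg.fn f x) e.inv_hom_id

/-- The pseudo-double category of polynomials, coalgebras and lax squares in `Org`. -/
def pseudoDoubleCategory : PseudoDoubleCategory cells.{u} where
  toSquareCategory := squareCategory
  hidSq φ := hrefl φ
  hcompSq a b := hpaste a b
  hidSq_id _ := ext_fn fun _ => rfl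
  hidSq_comp _ _ := ext_fn fun _ => rfl
  hcompSq_vid _ _ := ext_fn fun _ => rfl
  hcompSq_vcomp _ _ _ _ := ext_fn fun _ => rfl
  assoc S T U := globIsoOfIso (Bicategory.associator S T U)
  leftUnitor S := globIsoOfIso (Bicategory.leftUnitor S)
  rightUnitor S := globIsoOfIso (Bicategory.rightUnitor S)
  assoc_naturality _ _ _ := heq_of_fn rfl rfl fun _ => rfl
  leftUnitor_naturality _ := heq_of_fn rfl rfl fun _ => rfl
  rightUnitor_naturality _ := heq_of_fn rfl rfl fun _ => rfl
  pentagon _ _ _ _ := heq_of_fn rfl rfl fun _ => rfl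
  triangle _ _ := heq_of_fn rfl rfl fun _ => rfl

theorem pseudoDoubleCategory_extendsBicategory : ExtendsBicategory pseudoDoubleCategory.{u} where
  ofTwoCell_bijective := ofTwoCell_bijective
  ofTwoCell_id _ := rfl
  ofTwoCell_comp _ _ := heq_of_fn rfl rfl fun _ => rfl
  ofTwoCell_whiskerLeft _ _ _ _ := ext_fn fun _ => rfl
  ofTwoCell_whiskerRight _ _ := ext_fn fun _ => rfl
  ofTwoCell_associator _ _ _ := rfl
  ofTwoCell_leftUnitor _ := rfl
  ofTwoCell_rightUnitor _ := rfl
  vcomp_eq _ _ := rfl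
  hcompSq_eq _ _ := rfl
  hidSq_eq _ := rfl
  fn_vcomp _ _ _ := rfl
  fn_hcompSq _ _ _ _ := rfl

/-- The monoidal structure on the double category `Org` given by the Dirichlet tensor product. -/
def monoidalDoubleStructure : MonoidalDoubleStructure pseudoDoubleCategory.{u} tens where
  tensSq a b := Square.tensor a b
  tensSq_vid _ _ := heq_of_fn rfl rfl fun _ => rfl
  tensSq_vcomp _ _ _ _ := heq_of_fn rfl rfl fun _ => rfl
  tensAssoc _ _ _ :=
    { hom := ofFn (fun x => (x.1.1, (x.1.2, x.2))) fun _ => rfl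
      inv := ofFn (fun x => ((x.1, x.2.1), x.2.2)) fun _ => rfl
      hom_inv := heq_of_fn rfl rfl fun _ => rfl
      inv_hom := heq_of_fn rfl rfl fun _ => rfl }
  tensLeftUnitor _ :=
    { hom := ofFn (fun x => x.2) fun _ => rfl
      inv := ofFn (fun x => (PUnit.unit, x)) fun _ => rfl
      hom_inv := heq_of_fn rfl rfl fun _ => rfl
      inv_hom := heq_of_fn rfl rfl fun _ => rfl }
  tensRightUnitor _ :=
    { hom := ofFn (fun x => x.1) fun _ => rfl
      inv := ofFn (fun x => (x, PUnit.unit)) fun _ => rfl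
      hom_inv := heq_of_fn rfl rfl fun _ => rfl
      inv_hom := heq_of_fn rfl rfl fun _ => rfl }
  tensAssoc_naturality _ _ _ := heq_of_fn rfl rfl fun _ => rfl
  tensLeftUnitor_naturality _ := heq_of_fn rfl rfl fun _ => rfl
  tensRightUnitor_naturality _ := heq_of_fn rfl rfl fun _ => rfl
  tens_pentagon _ _ _ _ := heq_of_fn rfl rfl fun _ => rfl
  tens_triangle _ _ := heq_of_fn rfl rfl fun _ => rfl
  -- both composites send a flow `((I, I'), (k, k'))` to the same four updates, so the swap of the
  -- middle factors is an isomorphism of coalgebras, that is, an invertible 2-cell of `Org`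
  interchange S T S' T' := globIsoOfIso
    (HomCoalg.isoMk (S := HomCoalg.comp (HomCoalg.tensor S S') (HomCoalg.tensor T T'))
      (T := HomCoalg.tensor (HomCoalg.comp S T) (HomCoalg.comp S' T'))
      (Equiv.prodProdProdComm _ _ _ _) fun _ => rfl)
  unitInterchange p p' := globIsoOfIso
    (HomCoalg.isoMk (S := HomCoalg.singleton (𝟙 (p ⊗ p')))
      (T := HomCoalg.tensor (HomCoalg.singleton (𝟙 p)) (HomCoalg.singleton (𝟙 p')))
      (Equiv.punitProd PUnit).symm fun _ => rfl)
  interchange_naturality _ _ _ _ := heq_of_fn rfl rfl fun _ => rfl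
  unitInterchange_naturality _ _ := heq_of_fn rfl rfl fun _ => rfl
  interchange_assoc _ _ _ _ _ _ := heq_of_fn rfl rfl fun _ => rfl
  interchange_leftUnitor _ _ := heq_of_fn rfl rfl fun _ => rfl
  interchange_rightUnitor _ _ := heq_of_fn rfl rfl fun _ => rfl
  tensAssoc_hcomp _ _ _ _ _ _ := heq_of_fn rfl rfl fun _ => rfl
  tensAssoc_hid _ _ _ := heq_of_fn rfl rfl fun _ => rfl
  tensLeftUnitor_hcomp _ _ := heq_of_fn rfl rfl fun _ => rfl
  tensLeftUnitor_hid _ := heq_of_fn rfl rfl fun _ => rfl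
  tensRightUnitor_hcomp _ _ := heq_of_fn rfl rfl fun _ => rfl
  tensRightUnitor_hid _ := heq_of_fn rfl rfl fun _ => rfl

theorem monoidalDoubleStructure_isDirichlet : IsDirichlet monoidalDoubleStructure.{u} where
  fn_tensSq _ _ _ _ := rfl
  fn_tensAssoc _ _ _ _ _ _ := rfl
  fn_tensLeftUnitor _ _ := rfl
  fn_tensRightUnitor _ _ := rfl
  fn_interchange _ _ _ _ _ _ _ _ := rfl
  fn_unitInterchange _ _ := rfl

end Org

theorem mainTheorem4 :
    ∃ D : PseudoDoubleCategory Org.cells.{u}, Org.ExtendsBicategory D ∧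
      ∃ M : MonoidalDoubleStructure D Org.tens, Org.IsDirichlet M :=
  ⟨Org.pseudoDoubleCategory, Org.pseudoDoubleCategory_extendsBicategory,
    Org.monoidalDoubleStructure, Org.monoidalDoubleStructure_isDirichlet⟩
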